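/- Let $\mathbb{R}_+=[0,\infty)$ and let $s:\mathbb{R}_+\to\mathbb{C}$ belong to $L_{2,loc}(\mathbb{R}_+)$, i.e. $s$ is square integrable on $[0,b]$ for every $b>0$ (no other assumption, in particular no sectoriality, is made). For $y\in AC_{loc}(\mathbb{R}_+)$ (absolutely continuous on every $[0,b]$) put $y^{[1]}=y'-sy$, and, when also $y^{[1]}\in AC_{loc}(\mathbb{R}_+)$, put $$l(y)=-(y^{[1]})'-s\,y^{[1]}-s^2y,$$ the regularized form of $-y''+qy$ with the distributional potential $q=s'$. Let the minimal operator $L_0$ in $L_2(\mathbb{R}_+)$ be given by $L_0y=l(y)$ on the domain $$\mathscr{D}_0=\{y\in L_2(\mathbb{R}_+):\ y,\,y^{[1]}\in AC_{loc}(\mathbb{R}_+),\ l(y)\in L_2(\mathbb{R}_+),\ y(0)=y^{[1]}(0)=0,\ \operatorname{supp}y \text{ compact}\}.$$ If $L_0$ has an extension with compact resolvent, that is, a linear operator $L\supseteq L_0$ in $L_2(\mathbb{R}_+)$ such that for some $z\in\mathbb{C}$ the inverse $(L-z)^{-1}$ exists, is defined on all of $L_2(\mathbb{R}_+)$ and is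 compact, then $$\forall a>0\qquad \lim_{x\to+\infty}\int_x^{x+a}\int_x^{x+a}|s(\xi)-s(\eta)|^2\,d\xi\,d\eta=+\infty .$$ -/

import Mathlib

open MeasureTheory Filter Set

namespace SturmLiouville

/-- The Hilbert space `L₂(ℝ₊)` of complex-valued functions, `ℝ₊ = [0, ∞)`
(the endpoint `0` is a null set). -/
abbrev L2 : Type := Lp ℂ 2 (volume.restrict (Ioi (0 : ℝ)))

/-- `s ∈ L_{2,loc}(ℝ₊)`: square integrable on every `[0, b]`. Only the values of `s` on `(0, ∞)`
matter. -/
def L2Loc (s : ℝ → ℂ) : Prop :=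
  ∀ b : ℝ, 0 < b → MemLp s 2 (volume.restrict (Ioc 0 b))

/-- `y ∈ AC_loc(ℝ₊)`: absolutely continuous on every `[0, b]`. Only the values of `y` on `[0, ∞)`
matter. -/
def ACLoc (y : ℝ → ℂ) : Prop :=
  ∀ b : ℝ, 0 < b → AbsolutelyContinuousOnInterval y 0 b

/-- `u` is the (locally absolutely continuous) quasi-derivative `y^{[1]} = y' - s y`. As `y'` and
`s` are defined almost everywhere only, so is `y' - s y`; `u` is its continuous representative. -/
def IsQuasiDeriv (s y u : ℝ → ℂ) : Prop :=
  ACLoc u ∧ ∀ᵐ x ∂volume.restrict (Ioi (0 : ℝ)), u x = deriv y x - s x * y x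

/-- The differential expression `l(y) = -(y^{[1]})' - s y^{[1]} - s² y`, with `u = y^{[1]}`. -/
noncomputable def lExpr (s y u : ℝ → ℂ) (x : ℝ) : ℂ :=
  -deriv u x - s x * u x - s x ^ 2 * y x

/-- The pair `(f, g) ∈ L₂(ℝ₊) × L₂(ℝ₊)` satisfies `f ∈ 𝒟₀` and `g = l(f)`: the class `f` has
a representative `y ∈ AC_loc(ℝ₊)` whose quasi-derivative `u = y^{[1]}` is in `AC_loc(ℝ₊)`, with
`l(y) = g ∈ L₂(ℝ₊)`, `y(0) = y^{[1]}(0) = 0`, and `y` of compact support in `[0, ∞)`. -/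
def IsMinimalPair (s : ℝ → ℂ) (f g : L2) : Prop :=
  ∃ y u : ℝ → ℂ,
    (∀ᵐ x ∂volume.restrict (Ioi (0 : ℝ)), f x = y x) ∧
    ACLoc y ∧ IsQuasiDeriv s y u ∧
    (∀ᵐ x ∂volume.restrict (Ioi (0 : ℝ)), g x = lExpr s y u x) ∧
    y 0 = 0 ∧ u 0 = 0 ∧ ∃ b : ℝ, ∀ x : ℝ, b ≤ x → y x = 0

theorem ACLoc.ae_differentiableAt {y : ℝ → ℂ} (hy : ACLoc y) :
    ∀ᵐ x ∂volume.restrict (Ioi (0 : ℝ)), DifferentiableAt ℝ y x := by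
  have h : ∀ n : ℕ, ∀ᵐ x : ℝ, x ∈ uIcc (0 : ℝ) ((n : ℝ) + 1) → DifferentiableAt ℝ y x :=
    fun n => (hy ((n : ℝ) + 1) (by positivity)).boundedVariationOn.ae_differentiableAt_of_mem_uIcc
  rw [ae_restrict_iff' measurableSet_Ioi]
  filter_upwards [ae_all_iff.2 h] with x hx hx0
  obtain ⟨n, hn⟩ := exists_nat_ge x
  refine hx n ?_
  rw [uIcc_of_le (by positivity)]
  exact ⟨le_of_lt hx0, by linarith⟩

theorem ACLoc.add {y z : ℝ → ℂ} (hy : ACLoc y) (hz : ACLoc z) : ACLoc (y + z) :=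
  fun b hb => (hy b hb).add (hz b hb)

theorem ACLoc.smul {y : ℝ → ℂ} (c : ℂ) (hy : ACLoc y) : ACLoc (c • y) :=
  fun b hb => (hy b hb).const_smul c

theorem ACLoc.zero : ACLoc 0 := fun b _ => by
  simp [AbsolutelyContinuousOnInterval, tendsto_const_nhds]

/-- A locally absolutely continuous function vanishing almost everywhere on `(0, ∞)` vanishes
everywhere there. -/
theorem ACLoc.eq_zero {y : ℝ → ℂ} (hy : ACLoc y)
    (h : ∀ᵐ x ∂volume.restrict (Ioi (0 : ℝ)), y x = 0) : ∀ x, 0 < x → y x = 0 := by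
  have hc : ContinuousOn y (Ioi 0) := by
    intro x hx
    have hx' : (0 : ℝ) < x := hx
    have h1 := (hy (x + 1) (by linarith)).continuousOn
    rw [uIcc_of_le (by linarith)] at h1
    exact (h1.continuousAt (Icc_mem_nhds hx' (by linarith))).continuousWithinAt
  exact fun x hx => Measure.eqOn_open_of_ae_eq (f := y) (g := fun _ => 0) h isOpen_Ioi hc
    continuousOn_const hx

/-- The minimal pairs form a linear subspace of `L₂(ℝ₊) × L₂(ℝ₊)`. -/
def minimalGraph (s : ℝ → ℂ) : Submodule ℂ (L2 × L2) where
  carrier := {p | IsMinimalPair s p.1 p.2}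
  zero_mem' := by
    refine ⟨0, 0, ?_, ACLoc.zero, ⟨ACLoc.zero, ?_⟩, ?_, rfl, rfl, 0, fun _ _ => rfl⟩
    · exact Lp.coeFn_zero _ _ _
    · refine Eventually.of_forall fun x => ?_
      simp
    · filter_upwards [Lp.coeFn_zero ℂ 2 (volume.restrict (Ioi (0 : ℝ)))] with x hx
      simp only [Prod.snd_zero, hx]
      simp [lExpr]
  add_mem' := by
    rintro ⟨f, g⟩ ⟨f', g'⟩ ⟨y, u, hf, hy, ⟨hu, hq⟩, hg, hy0, hu0, b, hb⟩
      ⟨y', u', hf', hy', ⟨hu', hq'⟩, hg', hy0', hu0', b', hb'⟩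
    refine ⟨y + y', u + u', ?_, hy.add hy', ⟨hu.add hu', ?_⟩, ?_, by simp [hy0, hy0'],
      by simp [hu0, hu0'], max b b', fun x hx => ?_⟩
    · filter_upwards [hf, hf', Lp.coeFn_add f f'] with x h1 h2 h3
      simp_all
    · filter_upwards [hq, hq', hy.ae_differentiableAt, hy'.ae_differentiableAt] with x h1 h2 h3 h4
      simp only [Pi.add_apply, deriv_add h3 h4, h1, h2]
      ring
    · filter_upwards [hg, hg', Lp.coeFn_add g g', hu.ae_differentiableAt, hu'.ae_differentiableAt]
        with x h1 h2 h3 h4 h5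
      simp only [Prod.mk_add_mk] at *
      simp only [h3, Pi.add_apply, h1, h2, lExpr, deriv_add h4 h5]
      ring
    · simp [hb x (le_trans (le_max_left _ _) hx), hb' x (le_trans (le_max_right _ _) hx)]
  smul_mem' := by
    rintro c ⟨f, g⟩ ⟨y, u, hf, hy, ⟨hu, hq⟩, hg, hy0, hu0, b, hb⟩
    refine ⟨c • y, c • u, ?_, hy.smul c, ⟨hu.smul c, ?_⟩, ?_, by simp [hy0], by simp [hu0], b,
      fun x hx => by simp [hb x hx]⟩
    · filter_upwards [hf, Lp.coeFn_smul c f] with x h1 h2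
      simp_all
    · filter_upwards [hq, hy.ae_differentiableAt] with x h1 h2
      simp only [Pi.smul_apply, deriv_const_smul c h2, h1, smul_eq_mul]
      ring
    · filter_upwards [hg, Lp.coeFn_smul c g, hu.ae_differentiableAt] with x h1 h2 h3
      simp only [Prod.smul_mk] at *
      simp only [h2, Pi.smul_apply, h1, lExpr, deriv_const_smul c h3, smul_eq_mul]
      ring

/-- `l(f)` depends only on the class `f`: the minimal pairs form the graph of an operator. -/
theorem minimalGraph_snd_eq_zero (s : ℝ → ℂ) (p : L2 × L2) (hp : p ∈ minimalGraph s)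
    (h0 : p.1 = 0) : p.2 = 0 := by
  obtain ⟨y, u, hf, hy, ⟨hu, hq⟩, hg, -⟩ := hp
  have hy0 : ∀ x, 0 < x → y x = 0 := by
    refine hy.eq_zero ?_
    rw [h0] at hf
    filter_upwards [hf, Lp.coeFn_zero ℂ 2 (volume.restrict (Ioi (0 : ℝ)))] with x h1 h2
    rw [← h1, h2]; rfl
  have hd : ∀ {v : ℝ → ℂ}, (∀ x, 0 < x → v x = 0) → ∀ x, 0 < x → deriv v x = 0 := by
    intro v hv x hx
    have : v =ᶠ[nhds x] fun _ => 0 := by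
      filter_upwards [Ioi_mem_nhds hx] with t ht using hv t ht
    rw [this.deriv_eq]; simp
  have hu0 : ∀ x, 0 < x → u x = 0 := by
    refine hu.eq_zero ?_
    filter_upwards [hq, ae_restrict_mem measurableSet_Ioi] with x h1 h2
    rw [h1, hd hy0 x h2, hy0 x h2]; simp
  refine (Lp.eq_zero_iff_ae_eq_zero).2 ?_
  filter_upwards [hg, ae_restrict_mem measurableSet_Ioi] with x h1 h2
  rw [h1, lExpr, hd hu0 x h2, hu0 x h2, hy0 x h2]; simp

/-- The minimal operator `L₀ f = l(f)`, `f ∈ 𝒟₀`, in `L₂(ℝ₊)`. -/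
noncomputable def minimalOperator (s : ℝ → ℂ) : L2 →ₗ.[ℂ] L2 :=
  (minimalGraph s).toLinearPMap

/-- The graph of `L₀` consists exactly of the pairs `(f, l(f))`, `f ∈ 𝒟₀`. -/
theorem mem_graph_minimalOperator (s : ℝ → ℂ) (f g : L2) :
    (f, g) ∈ (minimalOperator s).graph ↔ IsMinimalPair s f g := by
  rw [minimalOperator, Submodule.toLinearPMap_graph_eq _ (minimalGraph_snd_eq_zero s)]
  rfl

/-- The bounded operator `R`, defined on the whole space, is the resolvent `(A - z)⁻¹` of `A`
at `z`. -/
def IsResolventAt (A : L2 →ₗ.[ℂ] L2) (z : ℂ) (R : L2 →L[ℂ] L2) : Prop :=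
  (∀ f : L2, ∃ x : A.domain, (x : L2) = R f ∧ A x - z • (x : L2) = f) ∧
    ∀ x : A.domain, R (A x - z • (x : L2)) = x

/-- `A` has compact resolvent: `(A - z)⁻¹` exists as a bounded everywhere defined operator and is
compact for some `z` (then it is compact for every `z` in the resolvent set). -/
def HasCompactResolvent (A : L2 →ₗ.[ℂ] L2) : Prop :=
  ∃ (z : ℂ) (R : L2 →L[ℂ] L2), IsResolventAt A z R ∧ IsCompactOperator R

end SturmLiouville

/-
The expression `l` is unchanged when `s` is replaced by `s - c`, so `l(φ) = 0` has a solution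
uniformly close to `1` on any interval where `1 + |s - c|` has small `L₂` norm. Cutting `φ` off
there gives `f ∈ 𝒟₀` with `‖f‖` bounded below and `‖f‖`, `‖l(f)‖` bounded above, depending only on
the length of the interval: since `l(φ) = 0`, the terms of `l(χ φ)` containing `s²` cancel. If the
oscillation integral stayed below `B` for arbitrarily large `x`, splitting `[x, x + a]` into
sufficiently many equal parts would produce such an interval of fixed length in each of these
windows. The unit ball of the graph of `L₀` would then contain functions of norm bounded below that
escape to infinity, and could not be precompact in `L₂(ℝ₊)`, as a compact resolvent of an extension
forces it to be.
-/

namespace SturmLiouville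

section AbsolutelyContinuous

theorem absolutelyContinuousOnInterval_of_dist_le {X Y : Type*} [PseudoMetricSpace X]
    [PseudoMetricSpace Y] {f : ℝ → X} {g : ℝ → Y} {a b : ℝ}
    (hg : AbsolutelyContinuousOnInterval g a b)
    (hfg : ∀ x ∈ uIcc a b, ∀ y ∈ uIcc a b, dist (f x) (f y) ≤ dist (g x) (g y)) :
    AbsolutelyContinuousOnInterval f a b :=
  squeeze_zero' (Eventually.of_forall fun _ => Finset.sum_nonneg fun _ _ => dist_nonneg)
    (eventually_inf_principal.2 <| Eventually.of_forall fun _ hE =>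
      Finset.sum_le_sum fun i hi => hfg _ (hE.1 i hi).1 _ (hE.1 i hi).2) hg

theorem absolutelyContinuousOnInterval_intervalIntegral {E : Type*} [NormedAddCommGroup E]
    [NormedSpace ℝ E] {f : ℝ → E} {a b c : ℝ} (hf : IntervalIntegrable f volume a b)
    (hc : c ∈ uIcc a b) : AbsolutelyContinuousOnInterval (fun x => ∫ t in c..x, f t) a b := by
  have hsub : ∀ x ∈ uIcc a b, IntervalIntegrable f volume c x := fun x hx =>
    hf.mono_set (uIcc_subset_uIcc hc hx)
  refine absolutelyContinuousOnInterval_of_dist_le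
    (hf.norm.absolutelyContinuousOnInterval_intervalIntegral hc) fun x hx y hy => ?_
  rw [dist_eq_norm, dist_eq_norm,
    intervalIntegral.integral_interval_sub_left (hsub x hx) (hsub y hy),
    intervalIntegral.integral_interval_sub_left (hsub x hx).norm (hsub y hy).norm,
    Real.norm_eq_abs]
  exact intervalIntegral.norm_integral_le_abs_integral_norm

theorem ACLoc.continuousOn_Ioi {y : ℝ → ℂ} (hy : ACLoc y) : ContinuousOn y (Ioi 0) := by
  intro x hx
  have hx1 : (0 : ℝ) < x + 1 := add_pos hx one_pos
  have hcont := (hy (x + 1) hx1).continuousOn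
  rw [uIcc_of_le hx1.le] at hcont
  exact (hcont.continuousAt (Icc_mem_nhds hx (lt_add_one x))).continuousWithinAt

end AbsolutelyContinuous

section LinearSystem

open scoped BoundedContinuousFunction

variable {𝕜 E : Type*} [NontriviallyNormedField 𝕜] [NormedAddCommGroup E] [NormedSpace 𝕜 E]
  {A : ℝ → E →L[𝕜] E}

theorem integrable_clm_apply (hA : Integrable A) (z : ℝ →ᵇ E) :
    Integrable fun t => A t (z t) :=
  (hA.norm.mul_const ‖z‖).mono'
    (isBoundedBilinearMap_apply.continuous.comp_aestronglyMeasurable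
      (hA.1.prodMk z.continuous.aestronglyMeasurable))
    (Eventually.of_forall fun t => (A t).le_of_opNorm_le_of_le le_rfl (z.norm_coe_le_norm t))

variable [NormedSpace ℝ E]

theorem norm_intervalIntegral_clm_apply_le (hA : Integrable A) (z : ℝ →ᵇ E) (a x : ℝ) :
    ‖∫ t in a..x, A t (z t)‖ ≤ (∫ t, ‖A t‖) * ‖z‖ :=
  calc ‖∫ t in a..x, A t (z t)‖ ≤ ∫ t in uIoc a x, ‖A t (z t)‖ :=
        intervalIntegral.norm_integral_le_integral_norm_uIoc
    _ ≤ ∫ t, ‖A t (z t)‖ := setIntegral_le_integral (integrable_clm_apply hA z).norm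
        (Eventually.of_forall fun _ => norm_nonneg _)
    _ ≤ ∫ t, ‖A t‖ * ‖z‖ := integral_mono (integrable_clm_apply hA z).norm
        (hA.norm.mul_const _) fun t => (A t).le_of_opNorm_le_of_le le_rfl (z.norm_coe_le_norm t)
    _ = (∫ t, ‖A t‖) * ‖z‖ := integral_mul_const _ _

/-- The Picard map `z ↦ z₀ + ∫ₐˣ A z` of the linear system `z' = A z`, `z a = z₀`. As `A` is
integrable on the whole line, it acts on the bounded continuous functions on `ℝ`. -/
noncomputable def picardMap (hA : Integrable A) (a : ℝ) (z₀ : E) (z : ℝ →ᵇ E) : ℝ →ᵇ E :=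
  BoundedContinuousFunction.ofNormedAddCommGroup (fun x => z₀ + ∫ t in a..x, A t (z t))
    (continuous_const.add (intervalIntegral.continuous_primitive
      (fun _ _ => (integrable_clm_apply hA z).intervalIntegrable) a))
    (‖z₀‖ + (∫ t, ‖A t‖) * ‖z‖)
    fun x => norm_add_le_of_le le_rfl (norm_intervalIntegral_clm_apply_le hA z a x)

theorem picardMap_apply (hA : Integrable A) (a : ℝ) (z₀ : E) (z : ℝ →ᵇ E) (x : ℝ) :
    picardMap hA a z₀ z x = z₀ + ∫ t in a..x, A t (z t) :=
  rfl

theorem contractingWith_picardMap (hA : Integrable A) (hA1 : ∫ t, ‖A t‖ < 1) (a : ℝ) (z₀ : E) :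
    ContractingWith ⟨∫ t, ‖A t‖, integral_nonneg fun _ => norm_nonneg _⟩ (picardMap hA a z₀) := by
  refine ⟨hA1, LipschitzWith.of_dist_le_mul fun z w => ?_⟩
  refine (BoundedContinuousFunction.dist_le
    (mul_nonneg (NNReal.coe_nonneg _) dist_nonneg)).2 fun x => ?_
  have hsub : picardMap hA a z₀ z x - picardMap hA a z₀ w x = ∫ t in a..x, A t ((z - w) t) := by
    simp only [picardMap_apply, add_sub_add_left_eq_sub, BoundedContinuousFunction.sub_apply,
      map_sub]
    exact (intervalIntegral.integral_sub (integrable_clm_apply hA z).intervalIntegrable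
      (integrable_clm_apply hA w).intervalIntegrable).symm
  rw [dist_eq_norm, dist_eq_norm, hsub]
  exact norm_intervalIntegral_clm_apply_le hA (z - w) a x

theorem exists_eq_add_intervalIntegral_clm_apply [CompleteSpace E] (hA : Integrable A)
    (hA1 : ∫ t, ‖A t‖ < 1) (a : ℝ) (z₀ : E) :
    ∃ z : ℝ →ᵇ E, (∀ x, z x = z₀ + ∫ t in a..x, A t (z t)) ∧
      ∀ x, ‖z x - z₀‖ ≤ (∫ t, ‖A t‖) * ‖z₀‖ / (1 - ∫ t, ‖A t‖) := by
  have hT := contractingWith_picardMap hA hA1 a z₀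
  set z := hT.fixedPoint _
  have hfix : picardMap hA a z₀ z = z := hT.fixedPoint_isFixedPt
  refine ⟨z, fun x => ?_, fun x => ?_⟩
  · rw [← picardMap_apply hA, hfix]
  · set w : ℝ →ᵇ E := BoundedContinuousFunction.const ℝ z₀
    have hw : dist w (picardMap hA a z₀ w) ≤ (∫ t, ‖A t‖) * ‖z₀‖ := by
      refine (BoundedContinuousFunction.dist_le (by positivity)).2 fun x => ?_
      rw [picardMap_apply, BoundedContinuousFunction.const_apply, dist_self_add_right]
      exact (norm_intervalIntegral_clm_apply_le hA w a x).trans (by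
        gcongr
        exact BoundedContinuousFunction.norm_const_le z₀)
    calc ‖z x - z₀‖ = dist (w x) (z x) := (dist_eq_norm' _ _).symm
      _ ≤ dist w z := BoundedContinuousFunction.dist_coe_le_dist x
      _ ≤ dist w (picardMap hA a z₀ w) / (1 - ∫ t, ‖A t‖) := hT.dist_fixedPoint_le w
      _ ≤ (∫ t, ‖A t‖) * ‖z₀‖ / (1 - ∫ t, ‖A t‖) := by
        have := sub_pos.2 hA1
        gcongr

theorem exists_absolutelyContinuousOnInterval_hasDerivAt_clm_apply [CompleteSpace E]
    (hA : Integrable A) (hA1 : ∫ t, ‖A t‖ < 1) (a : ℝ) (z₀ : E) :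
    ∃ z : ℝ → E, (∀ b, AbsolutelyContinuousOnInterval z a b) ∧
      (∀ᵐ x, HasDerivAt z (A x (z x)) x) ∧
      ∀ x, ‖z x - z₀‖ ≤ (∫ t, ‖A t‖) * ‖z₀‖ / (1 - ∫ t, ‖A t‖) := by
  obtain ⟨z, hz, hz₀⟩ := exists_eq_add_intervalIntegral_clm_apply hA hA1 a z₀
  have hint := integrable_clm_apply hA z
  refine ⟨z, fun b => ?_, ?_, hz₀⟩
  · refine absolutelyContinuousOnInterval_of_dist_le
      (absolutelyContinuousOnInterval_intervalIntegral hint.intervalIntegrable left_mem_uIcc)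
      fun x _ y _ => ?_
    rw [hz x, hz y, dist_add_left]
  · filter_upwards [LocallyIntegrable.ae_hasDerivAt_integral hint.locallyIntegrable] with x hx
    exact ((hx a).const_add z₀).congr_of_eventuallyEq (Eventually.of_forall hz)

end LinearSystem

section HomogeneousEquation

/-- The matrix of the first-order system `y' = p y + v`, `v' = -p² y - p v`, which is
`l(y) = 0`, `v = y^{[1]}` with `p` in place of `s`, acting on the pairs `(y, v)`. -/
noncomputable def systemMatrix (p : ℂ) : ℂ × ℂ →L[ℂ] ℂ × ℂ :=
  (p • ContinuousLinearMap.fst ℂ ℂ ℂ + ContinuousLinearMap.snd ℂ ℂ ℂ).prod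
    (-(p ^ 2 • ContinuousLinearMap.fst ℂ ℂ ℂ) - p • ContinuousLinearMap.snd ℂ ℂ ℂ)

theorem systemMatrix_apply (p : ℂ) (z : ℂ × ℂ) :
    systemMatrix p z = (p * z.1 + z.2, -(p ^ 2 * z.1) - p * z.2) :=
  rfl

theorem norm_systemMatrix_le (p : ℂ) : ‖systemMatrix p‖ ≤ (1 + ‖p‖) ^ 2 := by
  refine ContinuousLinearMap.opNorm_le_bound _ (by positivity) fun z => ?_
  have h₁ := norm_fst_le z
  have h₂ := norm_snd_le z
  rw [systemMatrix_apply]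
  refine norm_prod_le_iff.2 ⟨?_, ?_⟩
  · calc ‖p * z.1 + z.2‖ ≤ ‖p‖ * ‖z.1‖ + ‖z.2‖ := norm_add_le_of_le (norm_mul_le _ _) le_rfl
      _ ≤ ‖p‖ * ‖z‖ + ‖z‖ := by gcongr
      _ = (1 + ‖p‖) * ‖z‖ := by ring
      _ ≤ (1 + ‖p‖) ^ 2 * ‖z‖ := by
        gcongr
        exact le_self_pow₀ (le_add_of_nonneg_right (norm_nonneg p)) two_ne_zero
  · calc ‖-(p ^ 2 * z.1) - p * z.2‖ ≤ ‖p‖ ^ 2 * ‖z.1‖ + ‖p‖ * ‖z.2‖ :=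
          (norm_sub_le _ _).trans_eq (by rw [norm_neg, norm_mul, norm_pow, norm_mul])
      _ ≤ ‖p‖ ^ 2 * ‖z‖ + ‖p‖ * ‖z‖ := by gcongr
      _ ≤ (1 + ‖p‖) ^ 2 * ‖z‖ := by
        rw [← add_mul]
        gcongr
        linarith [norm_nonneg p]

theorem continuous_systemMatrix : Continuous systemMatrix :=
  (ContinuousLinearMap.prodₗᵢ ℂ).continuous.comp (by fun_prop : Continuous fun p : ℂ =>
    (p • ContinuousLinearMap.fst ℂ ℂ ℂ + ContinuousLinearMap.snd ℂ ℂ ℂ,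
      -(p ^ 2 • ContinuousLinearMap.fst ℂ ℂ ℂ) - p • ContinuousLinearMap.snd ℂ ℂ ℂ))

/-- `φ` solves `l(φ) = 0` on `S` with quasi-derivative `φ^{[1]} = u`; both functions are locally
absolutely continuous on the whole half-line. -/
structure IsHomogeneousSolutionOn (s : ℝ → ℂ) (S : Set ℝ) (φ u : ℝ → ℂ) : Prop where
  acLoc : ACLoc φ
  acLoc_quasiDeriv : ACLoc u
  ae_hasDerivAt : ∀ᵐ x, x ∈ S → HasDerivAt φ (s x * φ x + u x) x ∧
    HasDerivAt u (-(s x * u x) - s x ^ 2 * φ x) x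

theorem integrable_indicator_systemMatrix {p : ℝ → ℂ} {S : Set ℝ} (hS : MeasurableSet S)
    (hp : AEStronglyMeasurable p (volume.restrict S))
    (hint : IntegrableOn (fun t => (1 + ‖p t‖) ^ 2) S) :
    Integrable (S.indicator fun t => systemMatrix (p t)) :=
  (integrable_indicator_iff hS).2 <| hint.mono'
    (continuous_systemMatrix.comp_aestronglyMeasurable hp)
    (Eventually.of_forall fun t => norm_systemMatrix_le (p t))

theorem integral_norm_indicator_systemMatrix_le {p : ℝ → ℂ} {S : Set ℝ} (hS : MeasurableSet S)
    (hint : IntegrableOn (fun t => (1 + ‖p t‖) ^ 2) S) :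
    ∫ t, ‖S.indicator (fun t => systemMatrix (p t)) t‖ ≤ ∫ t in S, (1 + ‖p t‖) ^ 2 := by
  simp only [norm_indicator_eq_indicator_norm]
  rw [integral_indicator hS]
  exact integral_mono_of_nonneg (Eventually.of_forall fun _ => norm_nonneg _) hint
    (Eventually.of_forall fun t => norm_systemMatrix_le (p t))

/- The expression `l` does not change if `s` is replaced by `s - c`: this only turns the
quasi-derivative `u` into `v = u + c φ`. The system for `(φ, v)` has the small matrix
`systemMatrix (s - c)`. -/
theorem exists_isHomogeneousSolutionOn {s : ℝ → ℂ} {S : Set ℝ} {c : ℂ} (hS : MeasurableSet S)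
    (hs : AEStronglyMeasurable s (volume.restrict S))
    (hint : IntegrableOn (fun t => (1 + ‖s t - c‖) ^ 2) S)
    (hle : ∫ t in S, (1 + ‖s t - c‖) ^ 2 ≤ 1 / 4) :
    ∃ φ u : ℝ → ℂ, IsHomogeneousSolutionOn s S φ u ∧ (∀ x, ‖φ x - 1‖ ≤ 1 / 3) ∧
      ∀ x, ‖u x + c * φ x‖ ≤ 1 / 3 := by
  have hA := integrable_indicator_systemMatrix (p := fun t => s t - c) hS
    (hs.sub aestronglyMeasurable_const) hint
  have hA4 := (integral_norm_indicator_systemMatrix_le hS hint).trans hle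
  obtain ⟨z, hz, hz', hz₀⟩ := exists_absolutelyContinuousOnInterval_hasDerivAt_clm_apply hA
    (hA4.trans_lt (by norm_num)) 0 (1, 0)
  have hz3 (x : ℝ) : ‖z x - (1, 0)‖ ≤ 1 / 3 := by
    refine (hz₀ x).trans ?_
    rw [Prod.norm_mk, norm_one, norm_zero, max_eq_left zero_le_one, mul_one,
      div_le_iff₀ (by linarith)]
    linarith
  have hφ : ACLoc fun x => (z x).1 := fun b _ =>
    absolutelyContinuousOnInterval_of_dist_le (hz b) fun _ _ _ _ => le_max_left _ _
  have hv : ACLoc fun x => (z x).2 := fun b _ =>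
    absolutelyContinuousOnInterval_of_dist_le (hz b) fun _ _ _ _ => le_max_right _ _
  refine ⟨fun x => (z x).1, fun x => (z x).2 - c * (z x).1,
    ⟨hφ, fun b hb => (hv b hb).sub (hφ.smul c b hb), ?_⟩, fun x => ?_, fun x => ?_⟩
  · filter_upwards [hz'] with x hx hxS
    rw [indicator_of_mem hxS, systemMatrix_apply] at hx
    have hφ' : HasDerivAt (fun x => (z x).1) _ x := hx.fst
    have hv' : HasDerivAt (fun x => (z x).2) _ x := hx.snd
    exact ⟨hφ'.congr_deriv (by ring), (hv'.sub (hφ'.const_mul c)).congr_deriv (by ring)⟩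
  · exact (norm_fst_le _).trans (hz3 x)
  · rw [sub_add_cancel]
    simpa only [Prod.snd_sub, sub_zero] using (norm_snd_le _).trans (hz3 x)

end HomogeneousEquation

section Cutoff

/-- `χ` is a `C²` cutoff function with compact support in `U` that is bounded, together with its
first two derivatives, by `η`. -/
structure IsCutoff (U : Set ℝ) (η : ℝ) (χ : ℝ → ℂ) : Prop where
  contDiff : ContDiff ℝ 2 χ
  hasCompactSupport : HasCompactSupport χ
  tsupport_subset : tsupport χ ⊆ U
  norm_le : ∀ x, ‖χ x‖ ≤ η
  norm_deriv_le : ∀ x, ‖deriv χ x‖ ≤ η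
  norm_deriv_deriv_le : ∀ x, ‖deriv (deriv χ) x‖ ≤ η

namespace IsCutoff

variable {U : Set ℝ} {η : ℝ} {χ : ℝ → ℂ}

theorem contDiff_deriv (hχ : IsCutoff U η χ) : ContDiff ℝ 1 (deriv χ) :=
  (contDiff_succ_iff_deriv.1 (hχ.contDiff : ContDiff ℝ (1 + 1) χ)).2.2

theorem hasDerivAt (hχ : IsCutoff U η χ) (x : ℝ) : HasDerivAt χ (deriv χ x) x :=
  (hχ.contDiff.differentiable two_ne_zero x).hasDerivAt

theorem hasDerivAt_deriv (hχ : IsCutoff U η χ) (x : ℝ) :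
    HasDerivAt (deriv χ) (deriv (deriv χ) x) x :=
  (hχ.contDiff_deriv.differentiable one_ne_zero x).hasDerivAt

theorem apply_eq_zero (hχ : IsCutoff U η χ) {x : ℝ} (hx : x ∉ U) : χ x = 0 :=
  image_eq_zero_of_notMem_tsupport fun h => hx (hχ.tsupport_subset h)

theorem deriv_eq_zero (hχ : IsCutoff U η χ) {x : ℝ} (hx : x ∉ U) : deriv χ x = 0 :=
  image_eq_zero_of_notMem_tsupport fun h => hx (hχ.tsupport_subset (tsupport_deriv_subset h))

theorem deriv_deriv_eq_zero (hχ : IsCutoff U η χ) {x : ℝ} (hx : x ∉ U) : deriv (deriv χ) x = 0 :=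
  image_eq_zero_of_notMem_tsupport fun h =>
    hx (hχ.tsupport_subset (tsupport_deriv_subset (tsupport_deriv_subset h)))

theorem acLoc (hχ : IsCutoff U η χ) : ACLoc χ := fun _ _ =>
  (hχ.contDiff.of_le one_le_two).contDiffOn.absolutelyContinuousOnInterval

theorem acLoc_deriv (hχ : IsCutoff U η χ) : ACLoc (deriv χ) := fun _ _ =>
  hχ.contDiff_deriv.contDiffOn.absolutelyContinuousOnInterval

theorem comp_sub_const (hχ : IsCutoff U η χ) (α : ℝ) :
    IsCutoff ((· - α) ⁻¹' U) η fun x => χ (x - α) := by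
  have hderiv : deriv (fun x => χ (x - α)) = fun x => deriv χ (x - α) :=
    funext fun x => deriv_comp_sub_const χ α x
  refine ⟨hχ.contDiff.comp (contDiff_id.sub contDiff_const),
    hχ.hasCompactSupport.comp_homeomorph (Homeomorph.subRight α), ?_, fun x => hχ.norm_le _,
    fun x => ?_, fun x => ?_⟩
  · exact (tsupport_comp_eq_preimage χ (Homeomorph.subRight α)).trans_subset
      (preimage_mono hχ.tsupport_subset)
  · rw [hderiv]
    exact hχ.norm_deriv_le _
  · rw [hderiv, deriv_comp_sub_const]
    exact hχ.norm_deriv_deriv_le _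

end IsCutoff

theorem exists_isCutoff {U : Set ℝ} {x₀ η : ℝ} (hU : U ∈ nhds x₀) (hη : 0 < η) :
    ∃ χ, IsCutoff U η χ ∧ χ x₀ ≠ 0 := by
  obtain ⟨f, hfU, hfc, hf, -, hfx₀⟩ := exists_contDiff_tsupport_subset (n := 2) hU
  have hf₁ : ContDiff ℝ 1 (deriv f) := (contDiff_succ_iff_deriv.1 (hf : ContDiff ℝ (1 + 1) f)).2.2
  obtain ⟨D₀, hD₀⟩ := hfc.exists_bound_of_continuous hf.continuous
  obtain ⟨D₁, hD₁⟩ := hfc.deriv.exists_bound_of_continuous hf₁.continuous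
  obtain ⟨D₂, hD₂⟩ := hfc.deriv.deriv.exists_bound_of_continuous (hf₁.continuous_deriv le_rfl)
  set D := D₀ ⊔ D₁ ⊔ D₂
  have hD : 0 ≤ D := (norm_nonneg _).trans ((hD₂ x₀).trans le_sup_right)
  set r := η / (D + 1)
  have hr : 0 < r := by positivity
  have hrD : r * D ≤ η := by
    rw [div_mul_eq_mul_div, div_le_iff₀ (by positivity)]
    gcongr
    exact le_add_of_nonneg_right zero_le_one
  have hscale {g : ℝ → ℝ} {C : ℝ} (hg : ∀ x, ‖g x‖ ≤ C) (hC : C ≤ D) (x : ℝ) :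
      ‖((r * g x : ℝ) : ℂ)‖ ≤ η := by
    rw [Complex.norm_real, norm_mul, Real.norm_of_nonneg hr.le]
    exact (mul_le_mul_of_nonneg_left ((hg x).trans hC) hr.le).trans hrD
  have hderiv {g : ℝ → ℝ} (hg : Differentiable ℝ g) :
      deriv (fun x => ((r * g x : ℝ) : ℂ)) = fun x => ((r * deriv g x : ℝ) : ℂ) :=
    funext fun x => ((hg x).hasDerivAt.const_mul r).ofReal_comp.deriv
  have hχ₁ := hderiv (hf.differentiable two_ne_zero)
  have hχ₂ := hderiv (hf₁.differentiable one_ne_zero)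
  have hsupp : Function.support (fun x => ((r * f x : ℝ) : ℂ)) ⊆ Function.support f :=
    fun x hx h => hx (by simp [h])
  refine ⟨fun x => ((r * f x : ℝ) : ℂ), ⟨Complex.ofRealCLM.contDiff.comp (contDiff_const.mul hf),
    hfc.mono hsupp, (closure_mono hsupp).trans hfU, hscale hD₀ (le_sup_left.trans le_sup_left),
    ?_, ?_⟩, ?_⟩
  · rw [hχ₁]
    exact hscale hD₁ (le_sup_right.trans le_sup_left)
  · rw [hχ₁, hχ₂]
    exact hscale hD₂ le_sup_right
  · simpa [hfx₀] using hr.ne'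

theorem exists_isCutoff_Ioc_le_integral {δ η : ℝ} (hδ : 0 < δ) (hη : 0 < η) :
    ∃ ε > 0, ∀ α, ∃ χ, IsCutoff (Ioc α (α + δ)) η χ ∧ ε ≤ ∫ x, ‖χ x‖ ^ 2 := by
  obtain ⟨χ, hχ, hχ0⟩ :=
    exists_isCutoff (Ioc_mem_nhds (half_pos hδ) (half_lt_self hδ)) hη
  refine ⟨∫ x, ‖χ x‖ ^ 2, ?_, fun α => ⟨fun x => χ (x - α), ?_, ?_⟩⟩
  · refine Continuous.integral_pos_of_hasCompactSupport_nonneg_nonzero (x := δ / 2)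
      (hχ.contDiff.continuous.norm.pow 2) ?_ (fun x => sq_nonneg _) (by simpa using hχ0)
    exact hχ.hasCompactSupport.comp_left (g := fun z => ‖z‖ ^ 2) (by simp)
  · have h := hχ.comp_sub_const α
    rwa [preimage_sub_const_Ioc, zero_add, add_comm δ] at h
  · exact (integral_sub_right_eq_self (fun x => ‖χ x‖ ^ 2) α).ge

end Cutoff

section CutoffSolution

variable {s φ u χ : ℝ → ℂ} {S : Set ℝ} {η : ℝ}

theorem IsHomogeneousSolutionOn.isMinimalPair_cutoff (h : IsHomogeneousSolutionOn s S φ u)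
    (hS : S ⊆ Ioi 0) (hχ : IsCutoff S η χ) {f g : L2}
    (hf : f =ᵐ[volume.restrict (Ioi 0)] fun x => χ x * φ x)
    (hg : g =ᵐ[volume.restrict (Ioi 0)]
      fun x => -(deriv (deriv χ) x * φ x + 2 * deriv χ x * deriv φ x)) :
    IsMinimalPair s f g := by
  have h0 : (0 : ℝ) ∉ S := fun h => lt_irrefl (0 : ℝ) (hS h)
  obtain ⟨b, hb⟩ := hχ.hasCompactSupport.isCompact.bddAbove
  refine ⟨fun x => χ x * φ x, fun x => deriv χ x * φ x + χ x * u x, hf,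
    fun b hb => (hχ.acLoc b hb).fun_smul (h.acLoc b hb), ⟨fun b hb => ?_, ?_⟩, ?_,
    by simp only [hχ.apply_eq_zero h0, zero_mul],
    by simp only [hχ.apply_eq_zero h0, hχ.deriv_eq_zero h0, zero_mul, add_zero], b + 1,
    fun x hx => ?_⟩
  · exact ((hχ.acLoc_deriv b hb).fun_smul (h.acLoc b hb)).add
      ((hχ.acLoc b hb).fun_smul (h.acLoc_quasiDeriv b hb))
  · filter_upwards [ae_restrict_of_ae h.ae_hasDerivAt, h.acLoc.ae_differentiableAt]
      with x hx hφx
    rw [deriv_fun_mul (hχ.hasDerivAt x).differentiableAt hφx]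
    by_cases hxS : x ∈ S
    · rw [(hx hxS).1.deriv]
      ring
    · simp only [hχ.apply_eq_zero hxS, hχ.deriv_eq_zero hxS, zero_mul, mul_zero, add_zero,
        sub_zero]
  · filter_upwards [hg, ae_restrict_of_ae h.ae_hasDerivAt, h.acLoc.ae_differentiableAt,
      h.acLoc_quasiDeriv.ae_differentiableAt] with x hgx hx hφx hux
    have hu' : deriv (fun x => deriv χ x * φ x + χ x * u x) x = _ :=
      (((hχ.hasDerivAt_deriv x).mul hφx.hasDerivAt).add
        ((hχ.hasDerivAt x).mul hux.hasDerivAt)).deriv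
    rw [hgx, lExpr, hu']
    by_cases hxS : x ∈ S
    · rw [(hx hxS).1.deriv, (hx hxS).2.deriv]
      ring
    · simp only [hχ.apply_eq_zero hxS, hχ.deriv_eq_zero hxS, hχ.deriv_deriv_eq_zero hxS, zero_mul,
        mul_zero, add_zero, sub_zero]
  · have hx : x ∉ tsupport χ := fun hxs => (lt_add_one b).not_ge (hx.trans (hb hxs))
    simp only [image_eq_zero_of_notMem_tsupport hx, zero_mul]

theorem norm_toLp_sq {Ω E : Type*} [MeasurableSpace Ω] {μ : Measure Ω} [NormedAddCommGroup E]
    {h : Ω → E} (hh : MemLp h 2 μ) : ‖hh.toLp h‖ ^ 2 = ∫ x, ‖h x‖ ^ 2 ∂μ := by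
  rw [Lp.norm_toLp, hh.eLpNorm_eq_integral_rpow_norm two_ne_zero ENNReal.ofNat_ne_top,
    ENNReal.toReal_ofReal (by positivity), ENNReal.toReal_ofNat, ← Real.rpow_natCast,
    ← Real.rpow_mul (by positivity)]
  norm_num

theorem exists_Lp_two_norm_sq_le {Ω E : Type*} [MeasurableSpace Ω] {μ : Measure Ω}
    [NormedAddCommGroup E] {h : Ω → E} {k : Ω → ℝ} {S : Set Ω} (hh : AEStronglyMeasurable h μ)
    (hS : MeasurableSet S) (hk : IntegrableOn (fun x => k x ^ 2) S μ)
    (hle : ∀ᵐ x ∂μ, x ∈ S → ‖h x‖ ≤ k x) (h0 : ∀ x ∉ S, h x = 0) :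
    ∃ f : Lp E 2 μ, f =ᵐ[μ] h ∧ ‖f‖ ^ 2 = ∫ x, ‖h x‖ ^ 2 ∂μ ∧
      ‖f‖ ^ 2 ≤ ∫ x in S, k x ^ 2 ∂μ := by
  have hsupp : ∀ x ∉ S, ‖h x‖ ^ 2 = 0 := fun x hx => by rw [h0 x hx, norm_zero, sq, zero_mul]
  have hsq : ∀ᵐ x ∂μ.restrict S, ‖h x‖ ^ 2 ≤ k x ^ 2 := by
    filter_upwards [(ae_restrict_iff' hS).2 hle] with x hx
    gcongr
  have hint : IntegrableOn (fun x => ‖h x‖ ^ 2) S μ :=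
    hk.mono' (hh.restrict.norm.pow 2) (by simpa only [norm_pow, norm_norm] using hsq)
  have hL := (memLp_two_iff_integrable_sq_norm hh).2
    ((integrableOn_iff_integrable_of_support_subset fun x hx => by_contra fun hxS =>
      hx (hsupp x hxS)).1 hint)
  refine ⟨hL.toLp h, hL.coeFn_toLp, norm_toLp_sq hL, ?_⟩
  rw [norm_toLp_sq hL, ← setIntegral_eq_integral_of_forall_compl_eq_zero hsupp]
  exact integral_mono_ae hint hk hsq

theorem IsHomogeneousSolutionOn.ae_norm_deriv_le (h : IsHomogeneousSolutionOn s S φ u) {c : ℂ}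
    {B C : ℝ} (hφ : ∀ x, ‖φ x‖ ≤ B) (hu : ∀ x, ‖u x + c * φ x‖ ≤ C) :
    ∀ᵐ x, x ∈ S → ‖deriv φ x‖ ≤ B * ‖s x - c‖ + C := by
  filter_upwards [h.ae_hasDerivAt] with x hx hxS
  calc ‖deriv φ x‖ = ‖φ x * (s x - c) + (u x + c * φ x)‖ := by
        rw [(hx hxS).1.deriv]
        ring_nf
    _ ≤ B * ‖s x - c‖ + C := by
        refine norm_add_le_of_le ((norm_mul_le _ _).trans ?_) (hu x)
        gcongr
        exact hφ x

theorem IsHomogeneousSolutionOn.ae_norm_deriv_cutoff_le (h : IsHomogeneousSolutionOn s S φ u)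
    (hχ : IsCutoff S η χ) {c : ℂ} {B C : ℝ} (hφ : ∀ x, ‖φ x‖ ≤ B)
    (hu : ∀ x, ‖u x + c * φ x‖ ≤ C) :
    ∀ᵐ x, x ∈ S → ‖-(deriv (deriv χ) x * φ x + 2 * deriv χ x * deriv φ x)‖ ≤
      η * B + 2 * η * (B * ‖s x - c‖ + C) := by
  filter_upwards [h.ae_norm_deriv_le hφ hu] with x hφ' hx
  rw [norm_neg]
  exact norm_add_le_of_le (norm_mul_le_of_le (hχ.norm_deriv_deriv_le x) (hφ x))
    (norm_mul_le_of_le (norm_mul_le_of_le Complex.norm_two.le (hχ.norm_deriv_le x)) (hφ' hx))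

theorem IsCutoff.exists_L2_mul {b B : ℝ} {k : ℝ → ℝ} (hχ : IsCutoff S η χ)
    (hSm : MeasurableSet S) (hS : S ⊆ Ioi 0)
    (hφm : AEStronglyMeasurable φ (volume.restrict (Ioi 0))) (hb : 0 ≤ b)
    (hbφ : ∀ x, b ≤ ‖φ x‖) (hφB : ∀ x, ‖φ x‖ ≤ B) (hk : IntegrableOn (fun x => k x ^ 2) S)
    (hle : ∀ x, η * B ≤ k x) :
    ∃ f : L2, f =ᵐ[volume.restrict (Ioi 0)] (fun x => χ x * φ x) ∧
      b ^ 2 * ∫ x, ‖χ x‖ ^ 2 ≤ ‖f‖ ^ 2 ∧ ‖f‖ ^ 2 ≤ ∫ x in S, k x ^ 2 := by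
  obtain ⟨f, hf, hf_eq, hf_le⟩ := exists_Lp_two_norm_sq_le (h := fun x => χ x * φ x)
    (hχ.contDiff.continuous.aestronglyMeasurable.mul hφm) hSm hk.restrict
    (Eventually.of_forall fun x _ => (norm_mul_le_of_le (hχ.norm_le x) (hφB x)).trans (hle x))
    fun x hx => by rw [hχ.apply_eq_zero hx, zero_mul]
  rw [Measure.restrict_restrict_of_subset hS] at hf_le
  refine ⟨f, hf, ?_, hf_le⟩
  have h0 : ∀ x ∉ Ioi 0, ‖χ x‖ ^ 2 = 0 := fun x hx => by
    rw [hχ.apply_eq_zero fun hxS => hx (hS hxS), norm_zero, sq, zero_mul]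
  rw [hf_eq, ← setIntegral_eq_integral_of_forall_compl_eq_zero h0, ← integral_const_mul]
  refine integral_mono_of_nonneg (Eventually.of_forall fun x => by positivity)
    (((Lp.memLp f).ae_eq hf).integrable_norm_pow two_ne_zero) (Eventually.of_forall fun x => ?_)
  calc b ^ 2 * ‖χ x‖ ^ 2 ≤ ‖φ x‖ ^ 2 * ‖χ x‖ ^ 2 := by gcongr; exact hbφ x
    _ = ‖χ x * φ x‖ ^ 2 := by rw [norm_mul, mul_pow, mul_comm]

theorem IsHomogeneousSolutionOn.exists_L2_lExpr_cutoff (h : IsHomogeneousSolutionOn s S φ u)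
    {c : ℂ} {B C : ℝ} {k : ℝ → ℝ} (hχ : IsCutoff S η χ) (hSm : MeasurableSet S)
    (hS : S ⊆ Ioi 0) (hφ : ∀ x, ‖φ x‖ ≤ B) (hu : ∀ x, ‖u x + c * φ x‖ ≤ C)
    (hk : IntegrableOn (fun x => k x ^ 2) S)
    (hle : ∀ x, η * B + 2 * η * (B * ‖s x - c‖ + C) ≤ k x) :
    ∃ g : L2, g =ᵐ[volume.restrict (Ioi 0)]
        (fun x => -(deriv (deriv χ) x * φ x + 2 * deriv χ x * deriv φ x)) ∧
      ‖g‖ ^ 2 ≤ ∫ x in S, k x ^ 2 := by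
  have hφm : AEStronglyMeasurable φ (volume.restrict (Ioi 0)) :=
    h.acLoc.continuousOn_Ioi.aestronglyMeasurable measurableSet_Ioi
  have hχ₁m : AEStronglyMeasurable (deriv χ) (volume.restrict (Ioi 0)) :=
    hχ.contDiff_deriv.continuous.aestronglyMeasurable
  have hχ₂m : AEStronglyMeasurable (deriv (deriv χ)) (volume.restrict (Ioi 0)) :=
    (hχ.contDiff_deriv.continuous_deriv le_rfl).aestronglyMeasurable
  obtain ⟨g, hg, -, hg_le⟩ := exists_Lp_two_norm_sq_le
    (h := fun x => -(deriv (deriv χ) x * φ x + 2 * deriv χ x * deriv φ x))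
    ((hχ₂m.mul hφm).add ((hχ₁m.const_mul 2).mul (aestronglyMeasurable_deriv _ _))).neg
    hSm hk.restrict
    (by
      filter_upwards [ae_restrict_of_ae (h.ae_norm_deriv_cutoff_le hχ hφ hu)] with x hx hxS
      exact (hx hxS).trans (hle x))
    fun x hx => by
      rw [hχ.deriv_eq_zero hx, hχ.deriv_deriv_eq_zero hx, zero_mul, mul_zero, zero_mul, add_zero,
        neg_zero]
  rw [Measure.restrict_restrict_of_subset hS] at hg_le
  exact ⟨g, hg, hg_le⟩

theorem IsHomogeneousSolutionOn.exists_mem_minimalGraph (h : IsHomogeneousSolutionOn s S φ u)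
    (hSm : MeasurableSet S) (hS : S ⊆ Ioi 0) {c : ℂ} (hφ : ∀ x, ‖φ x - 1‖ ≤ 1 / 3)
    (hu : ∀ x, ‖u x + c * φ x‖ ≤ 1 / 3) (hχ : IsCutoff S (1 / 3) χ)
    (hint : IntegrableOn (fun t => (1 + ‖s t - c‖) ^ 2) S)
    (hle : ∫ t in S, (1 + ‖s t - c‖) ^ 2 ≤ 1) :
    ∃ p ∈ minimalGraph s, ‖p‖ ≤ 1 ∧ (2 / 3) ^ 2 * ∫ x, ‖χ x‖ ^ 2 ≤ ‖p.1‖ ^ 2 ∧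
      ∀ᵐ x ∂volume.restrict (Ioi 0), x ∉ S → p.1 x = 0 := by
  have hφ_le (x : ℝ) : ‖φ x‖ ≤ 4 / 3 := by
    linarith [norm_le_norm_add_norm_sub' (φ x) 1, hφ x, norm_one (α := ℂ)]
  have hφ_ge (x : ℝ) : 2 / 3 ≤ ‖φ x‖ := by
    linarith [norm_le_norm_add_norm_sub (φ x) 1, hφ x, norm_one (α := ℂ)]
  obtain ⟨f, hf, hf_ge, hf_le⟩ := hχ.exists_L2_mul hSm hS
    (h.acLoc.continuousOn_Ioi.aestronglyMeasurable measurableSet_Ioi) (by positivity) hφ_ge hφ_le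
    hint fun x => by linarith [norm_nonneg (s x - c)]
  obtain ⟨g, hg, hg_le⟩ := h.exists_L2_lExpr_cutoff hχ hSm hS hφ_le hu hint
    fun x => by linarith [norm_nonneg (s x - c)]
  refine ⟨(f, g), h.isMinimalPair_cutoff hS hχ hf hg, norm_prod_le_iff.2 ⟨?_, ?_⟩, hf_ge, ?_⟩
  · exact (sq_le_one_iff₀ (norm_nonneg _)).1 (hf_le.trans hle)
  · exact (sq_le_one_iff₀ (norm_nonneg _)).1 (hg_le.trans hle)
  · filter_upwards [hf] with x hx hxS
    rw [hx, hχ.apply_eq_zero hxS, zero_mul]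

theorem L2Loc.memLp_Ioc (hs : L2Loc s) {α β : ℝ} (hα : 0 ≤ α) :
    MemLp s 2 (volume.restrict (Ioc α β)) :=
  (hs (max β 1) (lt_max_of_lt_right one_pos)).mono_measure
    (Measure.restrict_mono (Ioc_subset_Ioc hα (le_max_left _ _)) le_rfl)

theorem L2Loc.integrableOn_one_add_norm_sub_sq (hs : L2Loc s) {α β : ℝ} (hα : 0 ≤ α) (c : ℂ) :
    IntegrableOn (fun t => (1 + ‖s t - c‖) ^ 2) (Ioc α β) :=
  ((memLp_const (1 : ℝ)).add ((hs.memLp_Ioc hα).sub (memLp_const c)).norm).integrable_sq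

theorem exists_mem_minimalGraph_of_setIntegral_le {δ : ℝ} (hδ : 0 < δ) :
    ∃ ε > 0, ∀ {s : ℝ → ℂ} {α : ℝ} {c : ℂ}, L2Loc s → 0 ≤ α →
      ∫ t in Ioc α (α + δ), (1 + ‖s t - c‖) ^ 2 ≤ 1 / 4 →
      ∃ p ∈ minimalGraph s, ‖p‖ ≤ 1 ∧ ε ≤ ‖p.1‖ ∧
        ∀ᵐ x ∂volume.restrict (Ioi 0), x ∉ Ioc α (α + δ) → p.1 x = 0 := by
  obtain ⟨ε, hε, hcut⟩ := exists_isCutoff_Ioc_le_integral hδ (η := 1 / 3) (by norm_num)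
  refine ⟨√((2 / 3) ^ 2 * ε), by positivity, fun {s α c} hs hα hle => ?_⟩
  have hint := hs.integrableOn_one_add_norm_sub_sq (β := α + δ) hα c
  obtain ⟨φ, u, hsol, hφ, hu⟩ :=
    exists_isHomogeneousSolutionOn measurableSet_Ioc (hs.memLp_Ioc hα).1 hint hle
  obtain ⟨χ, hχ, hχε⟩ := hcut α
  obtain ⟨p, hp, hp1, hpε, hp0⟩ := hsol.exists_mem_minimalGraph measurableSet_Ioc
    (fun x hx => hα.trans_lt hx.1) hφ hu hχ hint (hle.trans (by norm_num))
  refine ⟨p, hp, hp1, Real.sqrt_le_iff.2 ⟨norm_nonneg _, ?_⟩, hp0⟩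
  exact (mul_le_mul_of_nonneg_left hχε (by positivity)).trans hpε

end CutoffSolution

section Oscillation

theorem exists_measureReal_mul_integral_norm_sub_sq_le {Ω E : Type*} [MeasurableSpace Ω]
    [NormedAddCommGroup E] {μ : Measure Ω} [IsFiniteMeasure μ] [NeZero μ] {f : Ω → E}
    (hf : MemLp f 2 μ) :
    ∃ ω₀, μ.real univ * ∫ ω, ‖f ω - f ω₀‖ ^ 2 ∂μ ≤ ∫ ω, ∫ ω', ‖f ω - f ω'‖ ^ 2 ∂μ ∂μ := by
  have hint : Integrable (fun z : Ω × Ω => ‖f z.1 - f z.2‖ ^ 2) (μ.prod μ) :=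
    ((hf.comp_fst μ).sub (hf.comp_snd μ)).integrable_norm_pow two_ne_zero
  obtain ⟨ω₀, hω₀⟩ := exists_le_average (NeZero.ne μ) hint.integral_prod_left
  rw [average_eq, smul_eq_mul, ← div_eq_inv_mul, le_div_iff₀' measureReal_univ_pos] at hω₀
  exact ⟨ω₀, by simpa only [norm_sub_rev (f ω₀)] using hω₀⟩

theorem exists_mul_intervalIntegral_le {m : ℝ → ℝ} {x δ : ℝ} {n : ℕ} (hn : n ≠ 0) (hδ : 0 ≤ δ)
    (hm : IntervalIntegrable m volume x (x + n * δ)) :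
    ∃ i < n, n * ∫ t in x + i * δ..x + i * δ + δ, m t ≤ ∫ t in x..x + n * δ, m t := by
  have hnode {i : ℕ} (hi : i ≤ n) : x + i * δ ∈ uIcc x (x + n * δ) := by
    rw [uIcc_of_le (le_add_of_nonneg_right (by positivity))]
    exact ⟨le_add_of_nonneg_right (by positivity), by gcongr⟩
  have hsum : ∑ i ∈ Finset.range n, ∫ t in x + i * δ..x + (i + 1 : ℕ) * δ, m t =
      ∫ t in x..x + n * δ, m t := by
    rw [intervalIntegral.sum_integral_adjacent_intervals (a := fun i : ℕ => x + i * δ)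
      fun i hi => hm.mono_set (uIcc_subset_uIcc (hnode hi.le) (hnode hi))]
    simp
  obtain ⟨i, hi, hle⟩ := Finset.exists_le_of_sum_le (Finset.nonempty_range_iff.2 hn)
    (hsum.trans_le (by simp [field] : _ ≤ ∑ i ∈ Finset.range n, (∫ t in x..x + n * δ, m t) / n))
  refine ⟨i, Finset.mem_range.1 hi, ?_⟩
  rwa [le_div_iff₀' (by positivity), Nat.cast_succ, add_one_mul, ← add_assoc] at hle

theorem L2Loc.exists_setIntegral_one_add_norm_sub_sq_le {s : ℝ → ℂ} (hs : L2Loc s) {x a : ℝ}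
    (hx : 0 ≤ x) (ha : 0 < a) :
    ∃ c, ∫ t in Ioc x (x + a), (1 + ‖s t - c‖) ^ 2 ≤
      2 * a + 2 * ((∫ ξ in x..x + a, ∫ η in x..x + a, ‖s ξ - s η‖ ^ 2) / a) := by
  have hvol : (volume.restrict (Ioc x (x + a))).real univ = a := by simp [ha.le]
  have : NeZero (volume.restrict (Ioc x (x + a))) := ⟨by simp [ha]⟩
  have hL2 := hs.memLp_Ioc (β := x + a) hx
  obtain ⟨t₀, ht₀⟩ := exists_measureReal_mul_integral_norm_sub_sq_le hL2
  have hint : IntegrableOn (fun t => ‖s t - s t₀‖ ^ 2) (Ioc x (x + a)) :=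
    (hL2.sub (memLp_const (s t₀))).integrable_norm_pow two_ne_zero
  simp only [intervalIntegral.integral_of_le (le_add_of_nonneg_right ha.le)]
  rw [hvol, ← le_div_iff₀' ha] at ht₀
  refine ⟨s t₀, ?_⟩
  calc ∫ t in Ioc x (x + a), (1 + ‖s t - s t₀‖) ^ 2
      ≤ ∫ t in Ioc x (x + a), (2 + 2 * ‖s t - s t₀‖ ^ 2) :=
        integral_mono (hs.integrableOn_one_add_norm_sub_sq hx _)
          ((integrable_const _).add (hint.const_mul _))
          fun t => by linarith [add_sq_le (a := 1) (b := ‖s t - s t₀‖)]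
    _ = 2 * a + 2 * ∫ t in Ioc x (x + a), ‖s t - s t₀‖ ^ 2 := by
        rw [integral_add (integrable_const _) (hint.const_mul _), integral_const_mul,
          integral_const, hvol, smul_eq_mul, mul_comm a]
    _ ≤ _ := by gcongr

theorem exists_setIntegral_one_add_norm_sub_sq_le {a B κ : ℝ} (ha : 0 < a) (hκ : 0 < κ) :
    ∃ δ > 0, ∀ {s : ℝ → ℂ} {x : ℝ}, L2Loc s → 0 ≤ x →
      ∫ ξ in x..x + a, ∫ η in x..x + a, ‖s ξ - s η‖ ^ 2 ≤ B →
      ∃ α ≥ x, ∃ c, ∫ t in Ioc α (α + δ), (1 + ‖s t - c‖) ^ 2 ≤ κ := by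
  obtain ⟨n, hn⟩ := exists_nat_gt (max 0 ((2 * a + 2 * (B / a)) / κ))
  obtain ⟨hn0, hnκ⟩ := max_lt_iff.1 hn
  have hna : n * (a / n) = a := mul_div_cancel₀ a hn0.ne'
  have hδ : 0 < a / n := by positivity
  refine ⟨a / n, hδ, fun {s x} hs hx hB => ?_⟩
  obtain ⟨c, hc⟩ := hs.exists_setIntegral_one_add_norm_sub_sq_le hx ha
  have hint := hs.integrableOn_one_add_norm_sub_sq (β := x + n * (a / n)) hx c
  obtain ⟨i, -, hi⟩ := exists_mul_intervalIntegral_le (Nat.cast_pos.1 hn0).ne' hδ.le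
    ((intervalIntegrable_iff_integrableOn_Ioc_of_le (by simp [hna, ha.le])).2 hint)
  refine ⟨x + i * (a / n), le_add_of_nonneg_right (by positivity), c, ?_⟩
  rw [hna, intervalIntegral.integral_of_le (le_add_of_nonneg_right hδ.le),
    intervalIntegral.integral_of_le (le_add_of_nonneg_right ha.le)] at hi
  refine le_of_mul_le_mul_left ?_ hn0
  calc _ ≤ 2 * a + 2 * (B / a) := hi.trans (hc.trans (by gcongr))
    _ ≤ n * κ := ((div_lt_iff₀ hκ).1 hnκ).le

end Oscillation

section Compactness

theorem norm_le_norm_sub_of_disjoint {α E : Type*} [MeasurableSpace α] {μ : Measure α}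
    [NormedAddCommGroup E] {p : ENNReal} {f g : Lp E p μ} {S T : Set α} (hST : Disjoint S T)
    (hf : ∀ᵐ x ∂μ, x ∉ S → f x = 0) (hg : ∀ᵐ x ∂μ, x ∉ T → g x = 0) : ‖f‖ ≤ ‖f - g‖ := by
  refine Lp.norm_le_norm_of_ae_le ?_
  filter_upwards [hf, hg, Lp.coeFn_sub f g] with x hxf hxg hsub
  rw [hsub, Pi.sub_apply]
  by_cases hx : x ∈ S
  · rw [hxg (hST.notMem_of_mem_left hx), sub_zero]
  · rw [hxf hx, norm_zero]
    exact norm_nonneg _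

theorem exists_norm_sub_le_and_ae_lt_imp_eq_zero {E : Type*} [NormedAddCommGroup E]
    [NormedSpace ℝ E] {μ : Measure ℝ} [μ.Regular] {p : ENNReal} (hp : p ≠ ⊤)
    (f : Lp E p μ) {ε : ℝ} (hε : 0 < ε) :
    ∃ g : Lp E p μ, ‖f - g‖ ≤ ε ∧ ∀ᶠ X in atTop, ∀ᵐ x ∂μ, X < x → g x = 0 := by
  obtain ⟨g, hgc, hfg, -, hg⟩ := (Lp.memLp f).exists_hasCompactSupport_eLpNorm_sub_le hp
    (ENNReal.ofReal_pos.2 hε).ne'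
  obtain ⟨b, hb⟩ := hgc.isCompact.bddAbove
  refine ⟨hg.toLp g, ?_, ?_⟩
  · rw [← Lp.toLp_coeFn f (Lp.memLp f), ← MemLp.toLp_sub, Lp.norm_toLp]
    exact ENNReal.toReal_le_of_le_ofReal hε.le hfg
  · filter_upwards [eventually_ge_atTop b] with X hX
    filter_upwards [hg.coeFn_toLp] with x hx hXx
    rw [hx]
    exact image_eq_zero_of_notMem_tsupport fun hxg => (hX.trans_lt hXx).not_ge (hb hxg)

theorem eventually_norm_lt_of_totallyBounded {E : Type*} [NormedAddCommGroup E]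
    [NormedSpace ℝ E] {μ : Measure ℝ} [μ.Regular] {p : ENNReal} [Fact (1 ≤ p)] (hp : p ≠ ⊤)
    {K : Set (Lp E p μ)} (hK : TotallyBounded K) {ε : ℝ} (hε : 0 < ε) :
    ∀ᶠ X in atTop, ∀ f ∈ K, (∀ᵐ x ∂μ, x ≤ X → f x = 0) → ‖f‖ < ε := by
  obtain ⟨N, hN, hKN⟩ := Metric.totallyBounded_iff.1 hK (ε / 2) (half_pos hε)
  choose g hg_near hg_zero using fun f : Lp E p μ =>
    exists_norm_sub_le_and_ae_lt_imp_eq_zero hp f (half_pos hε)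
  filter_upwards [(eventually_all_finite hN).2 fun k _ => hg_zero k] with X hX f hf hf0
  obtain ⟨k, hk, hfk⟩ := mem_iUnion₂.1 (hKN hf)
  calc ‖f‖ ≤ ‖f - g k‖ := norm_le_norm_sub_of_disjoint (Iic_disjoint_Ioi le_rfl).symm
        (by simpa only [mem_Ioi, not_lt] using hf0) (by simpa only [mem_Iic, not_le] using hX k hk)
    _ ≤ ‖f - k‖ + ‖k - g k‖ := norm_sub_le_norm_sub_add_norm_sub _ _ _
    _ < ε / 2 + ε / 2 := add_lt_add_of_lt_of_le (mem_ball_iff_norm.1 hfk) (hg_near k)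
    _ = ε := add_halves ε

theorem IsResolventAt.apply_of_mem_graph {A : L2 →ₗ.[ℂ] L2} {z : ℂ} {R : L2 →L[ℂ] L2}
    (hR : IsResolventAt A z R) {p : L2 × L2} (hp : p ∈ A.graph) : R (p.2 - z • p.1) = p.1 := by
  obtain ⟨x, hx, hAx⟩ := (LinearPMap.mem_graph_iff A).1 hp
  rw [← hx, ← hAx]
  exact hR.2 x

theorem HasCompactResolvent.totallyBounded {A : L2 →ₗ.[ℂ] L2} (hA : HasCompactResolvent A) :
    TotallyBounded (Prod.fst '' ((A.graph : Set (L2 × L2)) ∩ Metric.closedBall 0 1)) := by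
  obtain ⟨z, R, hR, hRc⟩ := hA
  obtain ⟨K, hK, hRK⟩ := IsCompactOperator.image_closedBall_subset_compact
    (f := (R : L2 →ₗ[ℂ] L2)) hRc (1 + ‖z‖)
  refine hK.totallyBounded.subset ?_
  rintro _ ⟨p, ⟨hp, hp1⟩, rfl⟩
  rw [mem_closedBall_zero_iff] at hp1
  refine hRK ⟨p.2 - z • p.1, mem_closedBall_zero_iff.2 ?_, hR.apply_of_mem_graph hp⟩
  calc ‖p.2 - z • p.1‖ ≤ ‖p.2‖ + ‖z‖ * ‖p.1‖ := (norm_sub_le _ _).trans_eq (by rw [norm_smul])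
    _ ≤ 1 + ‖z‖ * 1 := by
        gcongr
        exacts [(norm_snd_le p).trans hp1, (norm_fst_le p).trans hp1]
    _ = 1 + ‖z‖ := by rw [mul_one]

end Compactness

end SturmLiouville

theorem theorem1_general (s : ℝ → ℂ) (hs : SturmLiouville.L2Loc s)
    (h : TotallyBounded (Prod.fst ''
      (((SturmLiouville.minimalOperator s).graph : Set (SturmLiouville.L2 × SturmLiouville.L2)) ∩
        Metric.closedBall 0 1))) :
    ∀ a : ℝ, 0 < a →
      Tendsto (fun x : ℝ => ∫ ξ in x..x + a, ∫ η in x..x + a, ‖s ξ - s η‖ ^ 2) atTop atTop := by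
  refine fun a ha => tendsto_atTop.2 fun B => ?_
  obtain ⟨δ, hδ, hosc⟩ :=
    SturmLiouville.exists_setIntegral_one_add_norm_sub_sq_le (B := B) (κ := 1 / 4) ha (by norm_num)
  obtain ⟨ε, hε, htest⟩ := SturmLiouville.exists_mem_minimalGraph_of_setIntegral_le hδ
  filter_upwards [SturmLiouville.eventually_norm_lt_of_totallyBounded (by norm_num) h hε,
    eventually_ge_atTop 0] with x hsmall hx
  by_contra! hB
  obtain ⟨α, hxα, c, hc⟩ := hosc hs hx hB.le
  obtain ⟨p, hp, hp1, hpε, hp0⟩ := htest hs (hx.trans hxα) hc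
  have hp_graph : p ∈ (SturmLiouville.minimalOperator s).graph :=
    (SturmLiouville.mem_graph_minimalOperator s p.1 p.2).2 hp
  refine (hsmall p.1 ⟨p, ⟨hp_graph, mem_closedBall_zero_iff.2 hp1⟩, rfl⟩ ?_).not_ge hpε
  filter_upwards [hp0] with t ht htx using ht fun htα => (htα.1.trans_le htx).not_ge hxα

theorem theorem1 (s : ℝ → ℂ) (hs : SturmLiouville.L2Loc s)
    (h : ∃ L : SturmLiouville.L2 →ₗ.[ℂ] SturmLiouville.L2,
      SturmLiouville.minimalOperator s ≤ L ∧ SturmLiouville.HasCompactResolvent L) :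
    ∀ a : ℝ, 0 < a →
      Tendsto (fun x : ℝ => ∫ ξ in x..x + a, ∫ η in x..x + a, ‖s ξ - s η‖ ^ 2) atTop atTop := by
  obtain ⟨L, hL, hLc⟩ := h
  exact theorem1_general s hs (hLc.totallyBounded.subset
    (image_mono (inter_subset_inter_left _ (LinearPMap.le_graph_of_le hL))))
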